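/- Let $L$ be a connected, simply connected (Hausdorff, finite-dimensional, real) Lie group that is solvable as a group, let $\varphi$ be a Lie group automorphism of $L$ (a group automorphism that is smooth with smooth inverse), and let $d\varphi_1\colon \mathfrak{l}\to\mathfrak{l}$ be its differential at the identity, an endomorphism of the Lie algebra $\mathfrak{l}=\mathrm{Lie}(L)=T_1L$. Suppose that the linear map $\mathrm{id}_{\mathfrak{l}}-d\varphi_1$ is invertible. Then the map $$\delta_\varphi\colon L\to L,\qquad \delta_\varphi(s)=s^{-1}\varphi(s),$$ is surjective. -/

import Mathlib

open scoped Manifold ContDiff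

noncomputable section

/-- The endomorphism of the Lie algebra `T₁ L` induced by a group automorphism `φ` of `L`: the
differential of `φ` at the identity. The derivative `mfderiv` lands in `T_{φ 1} L`, which is `T₁ L`
because `φ 1 = 1`; `TangentSpace` unfolds to the model space `E`, so no transport is visible.
It is meaningful when `φ` is smooth. -/
def lieAlgebraMap {E : Type*} [NormedAddCommGroup E] [NormedSpace ℝ E]
    {L : Type*} [TopologicalSpace L] [ChartedSpace E L] [Group L] (φ : L ≃* L) :
    GroupLieAlgebra 𝓘(ℝ, E) L →L[ℝ] GroupLieAlgebra 𝓘(ℝ, E) L :=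
  mfderiv 𝓘(ℝ, E) 𝓘(ℝ, E) φ (1 : L)

end

open Topology Filter

section TwistedConjugation

/-! The image of `s ↦ s⁻¹ φ(s)` is the orbit of `1` under the twisted action `x ↦ s⁻¹ x φ(s)`. The
orbit map at `x`, translated to fix `1`, has differential `Ad(x) ∘ dφ₁ - id`, which is invertible at
`x = 1`. Its determinant is constant on orbits and continuous in `x`, so it is nonzero on the
closure of that orbit. The inverse function theorem makes the orbit of every such point open, and
connectedness leaves only one. -/

/-- A `C¹` self-map of a boundaryless manifold modelled on a finite-dimensional space maps
neighbourhoods of a fixed point `a` to neighbourhoods of `a` when its differential at `a` has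
nonzero determinant. -/
theorem ContMDiffAt.map_nhds_eq_of_fixed_of_det_ne_zero
    {E : Type*} [NormedAddCommGroup E] [NormedSpace ℝ E] [FiniteDimensional ℝ E]
    {M : Type*} [TopologicalSpace M] [ChartedSpace E M]
    {f : M → M} {a : M} (hf : ContMDiffAt 𝓘(ℝ, E) 𝓘(ℝ, E) 1 f a) (ha : f a = a)
    {f' : E →L[ℝ] E} (hf' : mfderiv 𝓘(ℝ, E) 𝓘(ℝ, E) f a = f') (hdet : f'.det ≠ 0) :
    map f (𝓝 a) = 𝓝 a := by
  have : CompleteSpace E := FiniteDimensional.complete ℝ E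
  set e := chartAt E a with he
  have hsrc : a ∈ e.source := mem_chart_source E a
  let F : E → E := e ∘ f ∘ e.symm
  have hFc : ContDiffAt ℝ 1 F (e a) := by
    have := (contMDiffAt_iff.1 hf).2
    simpa [F, ha, contDiffWithinAt_univ, mfld_simps] using this
  have hFd : HasFDerivAt F f' (e a) := by
    have h1 := (hf.mdifferentiableAt one_ne_zero).hasMFDerivAt.2
    rw [hf'] at h1
    simp only [modelWithCornersSelf_coe, Set.range_id] at h1
    exact (hasFDerivWithinAt_univ.1 h1).congr_of_eventuallyEq (.of_eq <| by
      simp [F, ha, he, writtenInExtChartAt, mfld_simps])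
  have hFs : HasStrictFDerivAt F f' (e a) := by
    have := hFc.hasStrictFDerivAt one_ne_zero
    rwa [hFd.fderiv] at this
  have hFn : map F (𝓝 (e a)) = 𝓝 (e a) := by
    have := HasStrictFDerivAt.map_nhds_eq_of_equiv
      (f' := f'.toContinuousLinearEquivOfDetNeZero hdet) (f := F) (a := e a) (by simpa using hFs)
    simpa [F, hsrc, ha] using this
  have hfe : ∀ᶠ x in 𝓝 a, (e.symm ∘ F ∘ e) x = f x := by
    have h1 : ∀ᶠ x in 𝓝 a, f x ∈ e.source :=
      hf.continuousAt.eventually_mem (by rw [ha]; exact e.open_source.mem_nhds hsrc)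
    filter_upwards [h1, e.open_source.mem_nhds hsrc] with x hx hx'
    simp [F, e.left_inv hx', e.left_inv hx]
  rw [← Filter.map_congr hfe, ← Filter.map_map, ← Filter.map_map, e.map_nhds_eq hsrc, hFn,
    e.symm_map_nhds_eq hsrc]

section Group

variable {L : Type*} [Group L]

/-- The twisted conjugation orbit map of `x`, translated so that it fixes `1`. -/
def twistedOrbitMap (φ : L ≃* L) (x t : L) : L := t⁻¹ * (x * φ t * x⁻¹)

@[simp]
theorem twistedOrbitMap_one (φ : L ≃* L) (x : L) : twistedOrbitMap φ x 1 = 1 := by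
  simp [twistedOrbitMap]

/-- Moving along an orbit changes the map only by an inner automorphism, so the differentials at `1`
are similar. -/
theorem twistedOrbitMap_twisted_conj (φ : L ≃* L) (x s : L) :
    twistedOrbitMap φ (s⁻¹ * x * φ s) =
      (fun t => s⁻¹ * t * s) ∘ twistedOrbitMap φ x ∘ (fun t => s * t * s⁻¹) := by
  ext t
  simp [twistedOrbitMap, mul_assoc]

end Group

variable {E : Type*} [NormedAddCommGroup E] [NormedSpace ℝ E]
  {L : Type*} [TopologicalSpace L] [ChartedSpace E L] [Group L]

/-- The differential at `1` of a self-map of a Lie group, as an endomorphism of the model space. -/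
noncomputable def derivAtOne (E : Type*) [NormedAddCommGroup E] [NormedSpace ℝ E]
    {L : Type*} [TopologicalSpace L] [ChartedSpace E L] [Group L] (f : L → L) : E →L[ℝ] E :=
  mfderiv 𝓘(ℝ, E) 𝓘(ℝ, E) f (1 : L)

theorem derivAtOne_id : derivAtOne E (id : L → L) = ContinuousLinearMap.id ℝ E :=
  mfderiv_id

theorem derivAtOne_comp {f g : L → L} (hf : MDifferentiable 𝓘(ℝ, E) 𝓘(ℝ, E) f)
    (hg : MDifferentiable 𝓘(ℝ, E) 𝓘(ℝ, E) g) (h1 : g 1 = 1) :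
    derivAtOne E (f ∘ g) = (derivAtOne E f).comp (derivAtOne E g) :=
  (mfderiv_comp 1 (hf _) (hg 1)).trans
    (congrArg (ContinuousLinearMap.comp · (derivAtOne E g)) (mfderiv_congr_point h1))

/-- The differential at `1` of the translated twisted conjugation orbit map of `x`. -/
noncomputable def twistedOrbitDeriv (E : Type*) [NormedAddCommGroup E] [NormedSpace ℝ E]
    {L : Type*} [TopologicalSpace L] [ChartedSpace E L] [Group L] (φ : L ≃* L) (x : L) :
    E →L[ℝ] E :=
  derivAtOne E (twistedOrbitMap φ x)

variable [LieGroup 𝓘(ℝ, E) ∞ L] {φ : L ≃* L}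

theorem contMDiff_twistedOrbitMap (hφ : ContMDiff 𝓘(ℝ, E) 𝓘(ℝ, E) ∞ φ) :
    ContMDiff (𝓘(ℝ, E).prod 𝓘(ℝ, E)) 𝓘(ℝ, E) ∞ (Function.uncurry (twistedOrbitMap φ)) := by
  unfold twistedOrbitMap Function.uncurry
  exact contMDiff_snd.inv.mul ((contMDiff_fst.mul (hφ.comp contMDiff_snd)).mul contMDiff_fst.inv)

theorem contMDiff_twistedOrbitMap_apply (hφ : ContMDiff 𝓘(ℝ, E) 𝓘(ℝ, E) ∞ φ) (x : L) :
    ContMDiff 𝓘(ℝ, E) 𝓘(ℝ, E) ∞ (twistedOrbitMap φ x) :=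
  (contMDiff_twistedOrbitMap hφ).comp (contMDiff_const.prodMk contMDiff_id)

theorem continuous_twistedOrbitDeriv (hφ : ContMDiff 𝓘(ℝ, E) 𝓘(ℝ, E) ∞ φ) :
    Continuous (twistedOrbitDeriv E φ) := by
  have : IsManifold 𝓘(ℝ, E) 1 L := .of_le (n := ∞) (by simp)
  refine continuous_iff_continuousAt.2 fun x => ?_
  have h := ((contMDiff_twistedOrbitMap hφ).contMDiffAt (x := (x, 1))).mfderiv
    (m := 0) (twistedOrbitMap φ) (fun _ => 1) contMDiffAt_const (by simp)
  -- Base points in source and target are constantly `1`, so both coordinate changes are trivial.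
  have key (w : E) :
      (tangentBundleCore 𝓘(ℝ, E) L).coordChange (achart E 1) (achart E 1) 1 w = w :=
    (tangentBundleCore 𝓘(ℝ, E) L).coordChange_self _ _ (mem_chart_source E (1 : L)) w
  refine h.continuousAt.congr (Eventually.of_forall fun y => ?_)
  refine (inTangentCoordinates_eq (fun _ => 1) (fun x => twistedOrbitMap φ x 1)
    (twistedOrbitDeriv E φ) (by simp) (by simp)).trans ?_
  ext v
  simp only [twistedOrbitMap_one, ContinuousLinearMap.comp_apply, key]

theorem det_twistedOrbitDeriv_twisted_conj (hφ : ContMDiff 𝓘(ℝ, E) 𝓘(ℝ, E) ∞ φ) (x s : L) :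
    (twistedOrbitDeriv E φ (s⁻¹ * x * φ s)).det = (twistedOrbitDeriv E φ x).det := by
  have hc (r q : L) : MDifferentiable 𝓘(ℝ, E) 𝓘(ℝ, E) (fun t : L => r * t * q) :=
    (((contMDiff_const (n := ∞)).mul contMDiff_id).mul contMDiff_const).mdifferentiable (by simp)
  have hg := (contMDiff_twistedOrbitMap_apply hφ x).mdifferentiable (by simp)
  have h1 := derivAtOne_comp (hc s⁻¹ s) (hg.comp (hc s s⁻¹)) (by simp)
  rw [← twistedOrbitMap_twisted_conj, derivAtOne_comp hg (hc s s⁻¹) (by simp)] at h1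
  have h2 := derivAtOne_comp (hc s⁻¹ s) (hc s s⁻¹) (by simp)
  have h3 : (fun t : L => s⁻¹ * t * s) ∘ (fun t : L => s * t * s⁻¹) = id := by
    ext t; simp [mul_assoc]
  rw [h3, derivAtOne_id] at h2
  have hmul (A B : E →L[ℝ] E) : (A.comp B).det = A.det * B.det := LinearMap.det_comp _ _
  have h4 : (ContinuousLinearMap.id ℝ E).det = 1 := LinearMap.det_id
  rw [h2, hmul] at h4
  rw [twistedOrbitDeriv, h1, hmul, hmul, twistedOrbitDeriv]
  linear_combination (derivAtOne E (twistedOrbitMap φ x)).det * h4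

/-- Since `φ t = t * twistedOrbitMap φ 1 t` and multiplication has differential addition at `(1,
1)`, inversion need not be differentiated. -/
theorem derivAtOne_eq_id_add_twistedOrbitDeriv (hφ : ContMDiff 𝓘(ℝ, E) 𝓘(ℝ, E) ∞ φ) :
    derivAtOne E φ = ContinuousLinearMap.id ℝ E + twistedOrbitDeriv E φ 1 := by
  let m : L × L → L := fun p => p.1 * p.2
  have hm : MDifferentiable (𝓘(ℝ, E).prod 𝓘(ℝ, E)) 𝓘(ℝ, E) m :=
    (contMDiff_mul 𝓘(ℝ, E) ∞).mdifferentiable (by simp)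
  have hg := (contMDiff_twistedOrbitMap_apply hφ (1 : L)).mdifferentiable (by simp)
  have hφm : (φ : L → L) = m ∘ fun t => (t, twistedOrbitMap φ 1 t) := by
    ext t; simp [m, twistedOrbitMap]
  have hp : mfderiv 𝓘(ℝ, E) (𝓘(ℝ, E).prod 𝓘(ℝ, E)) (fun t : L => (t, twistedOrbitMap φ 1 t)) 1 =
      (ContinuousLinearMap.id ℝ E).prod (twistedOrbitDeriv E φ 1) :=
    (mfderiv_prodMk mdifferentiableAt_id (hg 1)).trans
      (congrArg (ContinuousLinearMap.prod · (twistedOrbitDeriv E φ 1)) derivAtOne_id)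
  have hm' : @Eq (E × E →L[ℝ] E)
      (mfderiv (𝓘(ℝ, E).prod 𝓘(ℝ, E)) 𝓘(ℝ, E) m (1, twistedOrbitMap φ 1 1))
      (ContinuousLinearMap.fst ℝ E E + ContinuousLinearMap.snd ℝ E E) := by
    have h1 : (fun z : L × L => m (z.1, 1)) = Prod.fst := by ext z; simp [m]
    have h2 : (fun z : L × L => m (1, z.2)) = Prod.snd := by ext z; simp [m]
    refine (mfderiv_congr_point (congrArg (Prod.mk (1 : L)) (twistedOrbitMap_one φ 1))).trans ?_
    exact (mfderiv_prod_eq_add (hm (1, 1))).trans <| congrArg₂ (fun A B : E × E →L[ℝ] E => A + B)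
      ((mfderiv_congr h1).trans mfderiv_fst) ((mfderiv_congr h2).trans mfderiv_snd)
  rw [derivAtOne, hφm]
  exact (mfderiv_comp 1 (hm _) (mdifferentiableAt_id.prodMk (hg 1))).trans <|
    (congrArg₂ (fun (A : E × E →L[ℝ] E) (B : E →L[ℝ] E × E) => A.comp B) hm' hp)

theorem det_twistedOrbitDeriv_one_ne_zero (hφ : ContMDiff 𝓘(ℝ, E) 𝓘(ℝ, E) ∞ φ)
    (hinv : IsUnit (ContinuousLinearMap.id ℝ (GroupLieAlgebra 𝓘(ℝ, E) L) -
      lieAlgebraMap (E := E) φ)) :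
    (twistedOrbitDeriv E φ 1).det ≠ 0 := by
  have h : IsUnit (ContinuousLinearMap.id ℝ E - derivAtOne E φ) := hinv
  rw [derivAtOne_eq_id_add_twistedOrbitDeriv hφ, sub_add_cancel_left, IsUnit.neg_iff] at h
  exact ((h.map ContinuousLinearMap.toLinearMapRingHom).map LinearMap.det).ne_zero

theorem eventually_mem_twisted_orbit [FiniteDimensional ℝ E]
    (hφ : ContMDiff 𝓘(ℝ, E) 𝓘(ℝ, E) ∞ φ) {x : L} (hx : (twistedOrbitDeriv E φ x).det ≠ 0) :
    ∀ᶠ y in 𝓝 x, ∃ t : L, t⁻¹ * x * φ t = y := by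
  have : IsTopologicalGroup L := topologicalGroup_of_lieGroup 𝓘(ℝ, E) ∞
  have h := ((contMDiff_twistedOrbitMap_apply hφ x).contMDiffAt.of_le
    (by simp)).map_nhds_eq_of_fixed_of_det_ne_zero (twistedOrbitMap_one φ x) rfl hx
  have h1 : ∀ᶠ z in 𝓝 (1 : L), ∃ t, twistedOrbitMap φ x t = z := by
    rw [← h]
    exact eventually_map.2 (Eventually.of_forall fun t => ⟨t, rfl⟩)
  have h2 : Tendsto (fun y => y * x⁻¹) (𝓝 x) (𝓝 1) := by
    have := (continuous_mul_const x⁻¹).tendsto x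
    rwa [mul_inv_cancel] at this
  filter_upwards [h2.eventually h1] with y ⟨t, ht⟩
  refine ⟨t, ?_⟩
  rw [twistedOrbitMap, ← mul_assoc, mul_left_inj] at ht
  rwa [← mul_assoc] at ht

/-- If `id - dφ₁` is invertible then the twisted conjugation action of a connected Lie group on
itself has a single orbit. The determinant of the orbit map's differential is continuous, and it is
constant on orbits, so the orbit of `1` is open and closed. -/
theorem surjective_inv_mul_of_isUnit_id_sub [FiniteDimensional ℝ E] [PreconnectedSpace L]
    (hφ : ContMDiff 𝓘(ℝ, E) 𝓘(ℝ, E) ∞ φ)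
    (hinv : IsUnit (ContinuousLinearMap.id ℝ (GroupLieAlgebra 𝓘(ℝ, E) L) -
      lieAlgebraMap (E := E) φ)) :
    Function.Surjective (fun s : L => s⁻¹ * φ s) := by
  set O : Set L := Set.range fun s : L => s⁻¹ * φ s with hO
  have h0 := det_twistedOrbitDeriv_one_ne_zero hφ hinv
  have hdet : ∀ x ∈ O, (twistedOrbitDeriv E φ x).det = (twistedOrbitDeriv E φ 1).det := by
    rintro _ ⟨s, rfl⟩
    simpa using det_twistedOrbitDeriv_twisted_conj hφ 1 s
  have hcont : Continuous fun x => (twistedOrbitDeriv E φ x).det :=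
    ContinuousLinearMap.continuous_det.comp (continuous_twistedOrbitDeriv hφ)
  have hopen : IsOpen O := by
    refine isOpen_iff_mem_nhds.2 fun x hx => ?_
    filter_upwards [eventually_mem_twisted_orbit hφ ((hdet x hx).symm ▸ h0)] with y ⟨t, ht⟩
    obtain ⟨s, rfl⟩ := hx
    exact ⟨s * t, by simpa [mul_assoc] using ht⟩
  have hclosed : IsClosed O := by
    refine isClosed_of_closure_subset fun x hx => ?_
    have hxdet : (twistedOrbitDeriv E φ x).det = (twistedOrbitDeriv E φ 1).det :=
      closure_minimal hdet (isClosed_eq hcont continuous_const) hx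
    -- The orbit of `x` is a neighbourhood of `x`, so it meets `O` at some `y`; orbits that meet
    -- coincide.
    obtain ⟨y, ⟨t, ht⟩, s, hs⟩ := mem_closure_iff_nhds.1 hx _
      (eventually_mem_twisted_orbit hφ (hxdet.symm ▸ h0))
    refine ⟨s * t⁻¹, ?_⟩
    have hx' : x = t * y * (φ t)⁻¹ := by rw [← ht]; group
    rw [hx', ← hs]
    simp [mul_assoc]
  exact Set.range_eq_univ.1 (IsClopen.eq_univ ⟨hclosed, hopen⟩ ⟨1, 1, by simp⟩)

end TwistedConjugation

theorem mainTheorem8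
    {E : Type*} [NormedAddCommGroup E] [NormedSpace ℝ E] [FiniteDimensional ℝ E]
    {L : Type*} [TopologicalSpace L] [T2Space L] [ChartedSpace E L] [Group L]
    [LieGroup 𝓘(ℝ, E) ∞ L]
    [ConnectedSpace L] [SimplyConnectedSpace L] [Group.IsSolvable L]
    (φ : L ≃* L)
    (hφ : ContMDiff 𝓘(ℝ, E) 𝓘(ℝ, E) ∞ φ)
    (hφ_symm : ContMDiff 𝓘(ℝ, E) 𝓘(ℝ, E) ∞ φ.symm)
    (hinv : IsUnit (ContinuousLinearMap.id ℝ (GroupLieAlgebra 𝓘(ℝ, E) L) -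
      lieAlgebraMap (E := E) φ)) :
    Function.Surjective (fun s : L => s⁻¹ * φ s) := by
  exact surjective_inv_mul_of_isUnit_id_sub hφ hinv
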